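/- For a positive integer $g$ and a commutative ring $R$, let $\mathrm{Sp}_{2g}(R)$ be the group of $2g\times 2g$ matrices $S$ over $R$ with $S^{T}\Omega S=\Omega$, where $\Omega=\begin{pmatrix}0&I_g\\-I_g&0\end{pmatrix}$. Let $\widehat{\mathbb Z}=\varprojlim_n \mathbb Z/n\mathbb Z$ be the ring of profinite integers, and give $\mathrm{Sp}_{2g}(\widehat{\mathbb Z})$ its profinite topology. For a subgroup $H\subset \mathrm{Sp}_{2g}(\widehat{\mathbb Z})$ and a positive integer $m$, let $H(m)\subset \mathrm{Sp}_{2g}(\mathbb Z/m\mathbb Z)$ denote the image of $H$ under reduction modulo $m$. Let $g\ge 1$ and let $G\subset \mathrm{Sp}_{2g}(\widehat{\mathbb Z})$ be an open subgroup. Then there exists a positive integer $M$ such that, for every closed subgroup $H\subset \mathrm{Sp}_{2g}(\widehat{\mathbb Z})$ contained in $G$, we have $H=G$ if and only if $H(M)=G(M)$ and $H(\ell)=\mathrm{Sp}_{2g}(\mathbb Z/\ell\mathbb Z)$ for every prime $\ell\nmid M$. -/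

import Mathlib

open Matrix

/-- The ring `Ẑ` of profinite integers, the inverse limit of the rings `ℤ/nℤ` over the positive
integers ordered by divisibility. Each `ZMod n` is discrete, the product carries the product
topology and `Ẑ` the subspace topology. -/
def ProfiniteInt : Subring (∀ n : ℕ+, ZMod (n : ℕ)) where
  carrier := {x | ∀ (m n : ℕ+) (h : (m : ℕ) ∣ (n : ℕ)), ZMod.castHom h (ZMod (m : ℕ)) (x n) = x m}
  mul_mem' := fun ha hb m n h => by
    rw [Pi.mul_apply, Pi.mul_apply, map_mul, ha m n h, hb m n h]
  one_mem' := fun m n h => by rw [Pi.one_apply, Pi.one_apply, map_one]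
  add_mem' := fun ha hb m n h => by
    rw [Pi.add_apply, Pi.add_apply, map_add, ha m n h, hb m n h]
  zero_mem' := fun m n h => by rw [Pi.zero_apply, Pi.zero_apply, map_zero]
  neg_mem' := fun ha m n h => by rw [Pi.neg_apply, Pi.neg_apply, map_neg, ha m n h]

/-- The reduction homomorphism `Ẑ → ℤ/mℤ`. -/
def ProfiniteInt.toZMod (m : ℕ+) : ProfiniteInt →+* ZMod (m : ℕ) :=
  (Pi.evalRingHom (fun n : ℕ+ => ZMod (n : ℕ)) m).comp ProfiniteInt.subtype

/-- `Sp_{2g}(R)`. As a subset of the matrices over a topological ring it carries the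
subspace topology. -/
abbrev Sp (g : ℕ) (R : Type*) [CommRing R] : Type _ := symplecticGroup (Fin g) R

/-- The homomorphism `Sp_{2g}(R) → Sp_{2g}(S)` applying a ring homomorphism to every entry. -/
def Sp.map (g : ℕ) {R S : Type*} [CommRing R] [CommRing S] (f : R →+* S) : Sp g R →* Sp g S where
  toFun A := ⟨(A : Matrix (Fin g ⊕ Fin g) (Fin g ⊕ Fin g) R).map f, SymplecticGroup.map_mem A.2 f⟩
  map_one' := Subtype.ext (Matrix.map_one f (map_zero f) (map_one f))
  map_mul' _ _ := Subtype.ext Matrix.map_mul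

/-- For a subgroup `H` of `Sp_{2g}(Ẑ)`, its mod-`m` reduction `H(m)`, a subgroup of
`Sp_{2g}(ℤ/mℤ)`. -/
def modReduction {g : ℕ} (H : Subgroup (Sp g ProfiniteInt)) (m : ℕ+) :
    Subgroup (Sp g (ZMod (m : ℕ))) :=
  H.map (Sp.map g (ProfiniteInt.toZMod m))

/-! An open `G` contains the kernel of reduction modulo some `N`, which may be enlarged to be
divisible by every prime up to `2 * (2 * g)! + 1`. Then `M = N ^ 2` works. As `H` is closed, it
suffices that `H` and `G` agree modulo every `k * N ^ 2`. This goes by induction on the prime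
factorization of `k`: passing from level `d` to `d * q`, elements of `G` trivial modulo `d` must be
matched by elements of `H`.

If `q ∣ d`, the kernel between the two levels is generated by transvections `1 + d E` with `E ^ 2 =
0`. Put `a = d / q`. The transvection `1 + a E` lifts to `G`, hence agrees modulo `d` with an
element of `H`, whose `q`-th power is `1 + d E` modulo `d * q` (`pow_prime_eq_one_add_nsmul`).

If `q ∤ d`, then `q` is large and `map_ker_eq_top` replaces Goursat's lemma and simplicity
arguments. A transvection modulo `q` lifts to an element `s` of a `q`-group `S`, and a torus element
is matched by some `x` normalizing `S`. Modulo a prime `p ∣ d`, the group `S` acts diagonalizably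
over the algebraic closure and `x` permutes at most `2 * g` weight spaces, so `x ^ (2 * g)!`
commutes with `s`. A power of their commutator, of exponent prime to `q`, is therefore trivial
modulo `d`, yet it is a nontrivial transvection modulo `q`. Its conjugates generate. -/

namespace Sp

/-! ### The symplectic form and transvections -/

variable {g : ℕ} {R S : Type*} [CommRing R] [CommRing S]

/-- The standard symplectic form on `R^{2g}`. -/
def form (v w : Fin g ⊕ Fin g → R) : R := v ⬝ᵥ J (Fin g) R *ᵥ w

theorem form_add_right (v w x : Fin g ⊕ Fin g → R) : form v (w + x) = form v w + form v x := by
  simp [form, mulVec_add]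

theorem form_swap (v w : Fin g ⊕ Fin g → R) : form w v = -form v w := by
  rw [form, form, dotProduct_comm, ← vecMul_transpose, J_transpose, vecMul_neg, neg_dotProduct,
    ← dotProduct_mulVec]

theorem form_sub_left (v w x : Fin g ⊕ Fin g → R) : form (v - w) x = form v x - form w x := by
  simp [form]

theorem form_sub_right (v w x : Fin g ⊕ Fin g → R) : form v (w - x) = form v w - form v x := by
  simp [form, mulVec_sub]

theorem form_self (v : Fin g ⊕ Fin g → R) : form v v = 0 := by
  simp [form, J, Matrix.fromBlocks_mulVec, dotProduct, neg_mulVec, mul_comm]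

theorem form_mulVec (A : Sp g R) (v w : Fin g ⊕ Fin g → R) :
    form (A.1 *ᵥ v) (A.1 *ᵥ w) = form v w := by
  rw [form, form, ← vecMul_transpose, dotProduct_mulVec, dotProduct_mulVec, vecMul_vecMul,
    vecMul_vecMul, ← Matrix.mul_assoc, SymplecticGroup.mem_iff'.1 A.2, ← dotProduct_mulVec]

theorem exists_form_ne_zero {v : Fin g ⊕ Fin g → R} (hv : v ≠ 0) : ∃ w, form v w ≠ 0 := by
  by_contra! h
  apply hv
  have h1 : v ᵥ* J (Fin g) R = 0 := by
    ext i
    have := h (Pi.single i 1)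
    rwa [form, dotProduct_mulVec, dotProduct_single_one] at this
  have h2 : v ᵥ* (J (Fin g) R * J (Fin g) R) = 0 := by rw [← vecMul_vecMul, h1, zero_vecMul]
  rwa [J_squared, vecMul_neg, vecMul_one, neg_eq_zero] at h2

/-- The nilpotent matrix `x ↦ ⟨v, x⟩ v`. -/
def rankOne (v : Fin g ⊕ Fin g → R) : Matrix (Fin g ⊕ Fin g) (Fin g ⊕ Fin g) R :=
  vecMulVec v v * J (Fin g) R

theorem rankOne_mulVec (v x : Fin g ⊕ Fin g → R) : rankOne v *ᵥ x = form v x • v := by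
  rw [rankOne, ← mulVec_mulVec, vecMulVec_mulVec, form, op_smul_eq_smul]

theorem vecMulVec_mul_J_mul_vecMulVec (v : Fin g ⊕ Fin g → R) :
    vecMulVec v v * J (Fin g) R * vecMulVec v v = 0 := by
  rw [Matrix.mul_assoc, mul_vecMulVec, vecMulVec_mul_vecMulVec]
  have := form_self v
  rw [form] at this
  rw [this]
  ext
  simp [vecMulVec]

theorem rankOne_mul_self (v : Fin g ⊕ Fin g → R) : rankOne v * rankOne v = 0 := by
  rw [rankOne, ← Matrix.mul_assoc, vecMulVec_mul_J_mul_vecMulVec, Matrix.zero_mul]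

/-- The symplectic transvection `x ↦ x + c ⟨v, x⟩ v`. -/
def transvection (v : Fin g ⊕ Fin g → R) (c : R) : Sp g R :=
  ⟨1 + c • rankOne v, by
    have h := vecMulVec_mul_J_mul_vecMulVec v
    rw [SymplecticGroup.mem_iff, rankOne]
    simp only [transpose_add, transpose_one, transpose_smul, transpose_mul, J_transpose,
      transpose_vecMulVec, add_mul, mul_add, one_mul, mul_one, Matrix.smul_mul, Matrix.mul_smul,
      Matrix.neg_mul, Matrix.mul_neg]
    rw [Matrix.mul_assoc (vecMulVec v v) (J _ R) (J _ R), ← Matrix.mul_assoc (J _ R) (J _ R),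
      J_squared]
    rw [Matrix.mul_assoc] at h
    simp [h]⟩

@[simp]
theorem coe_transvection (v : Fin g ⊕ Fin g → R) (c : R) :
    (transvection v c : Matrix (Fin g ⊕ Fin g) (Fin g ⊕ Fin g) R) = 1 + c • rankOne v := rfl

theorem transvection_mulVec (v x : Fin g ⊕ Fin g → R) (c : R) :
    (transvection v c).1 *ᵥ x = x + (c * form v x) • v := by
  rw [coe_transvection, add_mulVec, one_mulVec, smul_mulVec, rankOne_mulVec, smul_smul]

theorem transvection_add (v : Fin g ⊕ Fin g → R) (c d : R) :
    transvection v (c + d) = transvection v c * transvection v d := by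
  apply Subtype.ext
  simp only [coe_transvection, Submonoid.coe_mul]
  simp [add_mul, mul_add, rankOne_mul_self, add_smul]
  abel

@[simp]
theorem transvection_zero (v : Fin g ⊕ Fin g → R) : transvection v 0 = 1 := by
  apply Subtype.ext
  simp

theorem transvection_pow (v : Fin g ⊕ Fin g → R) (c : R) (n : ℕ) :
    transvection v c ^ n = transvection v (n * c) := by
  induction n with
  | zero => simp
  | succ n ih => rw [pow_succ, ih, ← transvection_add]; congr 1; push_cast; ring

theorem transvection_inv (v : Fin g ⊕ Fin g → R) (c : R) :
    (transvection v c)⁻¹ = transvection v (-c) := by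
  rw [inv_eq_iff_mul_eq_one, ← transvection_add, add_neg_cancel, transvection_zero]

theorem coe_mul_coe_inv (A : Sp g R) :
    (A : Matrix (Fin g ⊕ Fin g) (Fin g ⊕ Fin g) R) * (A⁻¹ : Sp g R).1 = 1 :=
  congrArg Subtype.val (mul_inv_cancel A)

theorem conj_transvection (A : Sp g R) (v : Fin g ⊕ Fin g → R) (c : R) :
    A * transvection v c * A⁻¹ = transvection (A.1 *ᵥ v) c := by
  rw [mul_inv_eq_iff_eq_mul]
  apply Subtype.ext
  simp only [coe_transvection, Submonoid.coe_mul, mul_add, add_mul, one_mul, mul_one, rankOne,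
    Matrix.smul_mul, Matrix.mul_smul]
  rw [← mul_vecMulVec, ← vecMul_transpose, ← vecMulVec_mul]
  simp only [Matrix.mul_assoc]
  rw [← Matrix.mul_assoc _ (J _ R), SymplecticGroup.mem_iff'.1 A.2]

theorem map_transvection (f : R →+* S) (v : Fin g ⊕ Fin g → R) (c : R) :
    Sp.map g f (transvection v c) = transvection (f ∘ v) (f c) := by
  apply Subtype.ext
  have : (rankOne v).map f = rankOne (f ∘ v) := by
    rw [rankOne, Matrix.map_mul, map_J, rankOne]
    congr 1
    ext
    simp [vecMulVec]
  change Matrix.map (1 + c • rankOne v) f = 1 + f c • rankOne (f ∘ v)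
  rw [Matrix.map_add _ (map_add f), Matrix.map_one _ (map_zero f) (map_one f),
    Matrix.map_smul' _ _ _ (fun a b => map_mul f a b), this]

theorem map_comp {T : Type*} [CommRing T] (f : R →+* S) (h : S →+* T) (A : Sp g R) :
    Sp.map g h (Sp.map g f A) = Sp.map g (h.comp f) A := rfl

/-! ### Generation by transvections over a field -/

section Field

variable {K : Type*} [Field K]

theorem transvection_sub_mulVec {v w : Fin g ⊕ Fin g → K} (h : form v w ≠ 0) :
    (transvection (w - v) (form v w)⁻¹).1 *ᵥ w = v := by
  rw [transvection_mulVec, form_sub_left, form_self, zero_sub, mul_neg, inv_mul_cancel₀ h]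
  simp

/-- Two linear forms that do not vanish are simultaneously nonzero at some vector. -/
theorem exists_form_ne_zero_and {u v x y : Fin g ⊕ Fin g → K} (hx : form u x ≠ 0)
    (hy : form v y ≠ 0) :
    ∃ z, (z = x ∨ z = y ∨ z = x + y) ∧ form u z ≠ 0 ∧ form v z ≠ 0 := by
  by_cases h1 : form v x = 0
  · by_cases h2 : form u y = 0
    · exact ⟨x + y, by simp, by simpa [form_add_right, h2], by simpa [form_add_right, h1]⟩
    · exact ⟨y, by simp, h2, hy⟩
  · exact ⟨x, by simp, hx, h1⟩

/-- Transvections act transitively on nonzero vectors. -/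
theorem exists_mulVec_eq {v w : Fin g ⊕ Fin g → K} (hv : v ≠ 0) (hw : w ≠ 0) :
    ∃ A : Sp g K, A.1 *ᵥ w = v := by
  obtain ⟨x, hx⟩ := exists_form_ne_zero hv
  obtain ⟨y, hy⟩ := exists_form_ne_zero hw
  -- One transvection joins two non-orthogonal vectors, so the path goes through a `z` orthogonal to
  -- neither.
  obtain ⟨z, -, h1, h2⟩ := exists_form_ne_zero_and hx hy
  have h3 : form z w ≠ 0 := by rw [form_swap]; simpa
  refine ⟨transvection (z - v) (form v z)⁻¹ * transvection (w - z) (form z w)⁻¹, ?_⟩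
  rw [Submonoid.coe_mul, ← mulVec_mulVec, transvection_sub_mulVec h3, transvection_sub_mulVec h1]

/-- The subspace of vectors fixed by a symplectic matrix. -/
def fixedSpace (A : Sp g K) : Submodule K (Fin g ⊕ Fin g → K) :=
  LinearMap.ker (A.1 - 1).mulVecLin

theorem mem_fixedSpace {A : Sp g K} {x : Fin g ⊕ Fin g → K} :
    x ∈ fixedSpace A ↔ A.1 *ᵥ x = x := by
  simp [fixedSpace, sub_eq_zero]

/-- The range of `A - 1` is orthogonal only to fixed vectors: by invariance, `⟨u, A x - x⟩ = -⟨A u -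
u, A x⟩`, and the form is nondegenerate. -/
theorem exists_form_mulVec_sub_ne_zero {A : Sp g K} {u : Fin g ⊕ Fin g → K}
    (hu : A.1 *ᵥ u ≠ u) : ∃ x, form u (A.1 *ᵥ x - x) ≠ 0 := by
  by_contra! h
  obtain ⟨y, hy⟩ := exists_form_ne_zero (sub_ne_zero.2 hu)
  apply hy
  have h1 := h ((A⁻¹ : Sp g K).1 *ᵥ y)
  rw [mulVec_mulVec, coe_mul_coe_inv, one_mulVec, form_sub_right] at h1
  have h2 := form_mulVec A u ((A⁻¹ : Sp g K).1 *ᵥ y)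
  rw [mulVec_mulVec, coe_mul_coe_inv, one_mulVec] at h2
  rw [form_sub_left, h2, ← neg_sub, h1, neg_zero]

/-- The range of `A - 1` is orthogonal to the vectors fixed by `A`. -/
theorem transvection_mulVec_of_mem_fixedSpace {A : Sp g K} {f : Fin g ⊕ Fin g → K}
    (hf : A.1 *ᵥ f = f) (x : Fin g ⊕ Fin g → K) (c : K) :
    (transvection (A.1 *ᵥ x - x) c).1 *ᵥ f = f := by
  have : form (A.1 *ᵥ x - x) f = 0 := by
    rw [form_sub_left, sub_eq_zero]
    nth_rw 1 [← hf]
    exact form_mulVec A x f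
  rw [transvection_mulVec, this]
  simp

/-- Transvections along the range of `A - 1` lose no fixed vector, so it is enough to bring `A u`
back to `u` with them. One suffices if `⟨u, A u⟩ ≠ 0`; otherwise two do, through `w = u + (A z - z)`
orthogonal to neither end. -/
theorem exists_fixedSpace_lt (H : Subgroup (Sp g K)) (hH : ∀ v c, transvection v c ∈ H)
    {A : Sp g K} {u : Fin g ⊕ Fin g → K} (hu : A.1 *ᵥ u ≠ u) :
    ∃ τ ∈ H, fixedSpace A < fixedSpace (τ * A) := by
  suffices h : ∃ τ ∈ H, τ.1 *ᵥ (A.1 *ᵥ u) = u ∧ ∀ f, A.1 *ᵥ f = f → τ.1 *ᵥ f = f by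
    obtain ⟨τ, hτ, h1, h2⟩ := h
    refine ⟨τ, hτ, lt_of_le_of_ne (fun f hf => ?_) fun h => ?_⟩
    · rw [mem_fixedSpace] at hf ⊢
      rw [Submonoid.coe_mul, ← mulVec_mulVec, hf, h2 f hf]
    · apply hu
      rw [← mem_fixedSpace, h, mem_fixedSpace, Submonoid.coe_mul, ← mulVec_mulVec, h1]
  by_cases h0 : form u (A.1 *ᵥ u) = 0
  · obtain ⟨x, hx⟩ := exists_form_mulVec_sub_ne_zero hu
    have hu' : A.1 *ᵥ (A.1 *ᵥ u) ≠ A.1 *ᵥ u := fun h => hu <| by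
      have := congrArg ((A⁻¹ : Sp g K).1 *ᵥ ·) h
      have hA : (A⁻¹ : Sp g K).1 * A.1 = 1 := congrArg Subtype.val (inv_mul_cancel A)
      simpa only [mulVec_mulVec, ← Matrix.mul_assoc, hA, one_mulVec, Matrix.one_mul] using this
    obtain ⟨y, hy⟩ := exists_form_mulVec_sub_ne_zero hu'
    obtain ⟨r, hr, h1, h2⟩ := exists_form_ne_zero_and hx hy
    obtain ⟨z, rfl⟩ : ∃ z, r = A.1 *ᵥ z - z := by
      rcases hr with rfl | rfl | rfl
      exacts [⟨x, rfl⟩, ⟨y, rfl⟩, ⟨x + y, by rw [mulVec_add]; abel⟩]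
    set w := u + (A.1 *ᵥ z - z) with hw
    have h3 : form u w ≠ 0 := by rwa [hw, form_add_right, form_self, zero_add]
    have h4 : form w (A.1 *ᵥ u) ≠ 0 := by
      rw [form_swap, neg_ne_zero, hw, form_add_right, form_swap, h0, neg_zero, zero_add]
      exact h2
    refine ⟨transvection (w - u) (form u w)⁻¹ * transvection (A.1 *ᵥ u - w) (form w (A.1 *ᵥ u))⁻¹,
      mul_mem (hH _ _) (hH _ _), ?_, fun f hf => ?_⟩
    · rw [Submonoid.coe_mul, ← mulVec_mulVec, transvection_sub_mulVec h4,
        transvection_sub_mulVec h3]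
    · have e1 : A.1 *ᵥ u - w = A.1 *ᵥ (u - z) - (u - z) := by rw [hw, mulVec_sub]; abel
      have e2 : w - u = A.1 *ᵥ z - z := by rw [hw]; abel
      rw [Submonoid.coe_mul, ← mulVec_mulVec, e1, e2, transvection_mulVec_of_mem_fixedSpace hf,
        transvection_mulVec_of_mem_fixedSpace hf]
  · exact ⟨_, hH _ _, transvection_sub_mulVec h0,
      fun f hf => transvection_mulVec_of_mem_fixedSpace hf _ _⟩

/-- The symplectic group over a field is generated by transvections. -/
theorem eq_top_of_transvection_mem (H : Subgroup (Sp g K)) (hH : ∀ v c, transvection v c ∈ H) :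
    H = ⊤ := by
  rw [eq_top_iff]
  rintro A -
  induction h : fixedSpace A using WellFoundedGT.induction generalizing A with
  | ind W ih =>
    by_cases hA : ∃ u, A.1 *ᵥ u ≠ u
    · obtain ⟨u, hu⟩ := hA
      obtain ⟨τ, hτ, hlt⟩ := exists_fixedSpace_lt H hH hu
      have := ih _ (h ▸ hlt) rfl
      simpa using mul_mem (inv_mem hτ) this
    · push Not at hA
      have : A = 1 := Subtype.ext (Matrix.ext_of_mulVec_single fun i => by
        rw [hA, Submonoid.coe_one, one_mulVec])
      exact this ▸ one_mem H

/-- A normal subgroup containing the transvections along one nonzero vector is everything. -/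
theorem eq_top_of_normal (H : Subgroup (Sp g K)) [H.Normal] {v : Fin g ⊕ Fin g → K} (hv : v ≠ 0)
    (h : ∀ c, transvection v c ∈ H) : H = ⊤ := by
  refine eq_top_of_transvection_mem H fun w c => ?_
  by_cases hw : w = 0
  · have : transvection w c = 1 := Subtype.ext (by simp [hw, rankOne])
    exact this ▸ one_mem H
  · obtain ⟨A, rfl⟩ := exists_mulVec_eq hw hv
    rw [← conj_transvection]
    exact Subgroup.Normal.conj_mem inferInstance _ (h c) A

end Field

end Sp

/-! ### Representations of `ℓ`-groups where `ℓ` is invertible -/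

section Coprime

open Module Module.End
open scoped commutatorElement

variable {K V S : Type*} [Field K] [AddCommGroup V] [Module K V] [Group S]
  {ℓ : ℕ}

theorem isSemisimple_of_pow_eq_one {f : End K V} {n : ℕ} (hn : (n : K) ≠ 0) (hf : f ^ n = 1) :
    f.IsSemisimple := by
  have hsq : Squarefree (Polynomial.X ^ n - Polynomial.C (1 : K)) :=
    (Polynomial.separable_X_pow_sub_C 1 hn one_ne_zero).squarefree
  exact isSemisimple_of_squarefree_aeval_eq_zero hsq (by simp [hf])

theorem IsPGroup.isSemisimple_apply (hS : IsPGroup ℓ S) (hℓ : (ℓ : K) ≠ 0) (ρ : S →* End K V)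
    (s : S) : (ρ s).IsSemisimple := by
  obtain ⟨k, hk⟩ := isPGroup_iff_pow_pow_eq_one.1 hS s
  exact isSemisimple_of_pow_eq_one (n := ℓ ^ k) (by simp [hℓ]) (by rw [← map_pow, hk, map_one])

variable [FiniteDimensional K V]

/-- In a representation of an `ℓ`-group of degree less than `ℓ`, a commutator that acts centrally
acts trivially. -/
theorem IsPGroup.apply_commutator_eq_one [IsAlgClosed K] (hp : ℓ.Prime) (hS : IsPGroup ℓ S)
    (hℓ : (ℓ : K) ≠ 0) (hV : finrank K V < ℓ) (ρ : S →* End K V) {s t : S}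
    (hs : Commute (ρ ⁅s, t⁆) (ρ s)) (ht : Commute (ρ ⁅s, t⁆) (ρ t)) : ρ ⁅s, t⁆ = 1 := by
  set z := ρ ⁅s, t⁆ with hz
  -- On the `μ`-eigenspace of `z`, `s t = μ t s`; determinants give `μ ^ dim = 1`. Also `μ` has
  -- `ℓ`-power order and `0 < dim < ℓ`, so `μ = 1`.
  have hbot : ∀ μ : K, μ ≠ 1 → z.eigenspace μ = ⊥ := by
    intro μ hμ
    by_contra hW
    obtain ⟨v, hv⟩ := HasEigenvalue.exists_hasEigenvector hW
    obtain ⟨k, hk⟩ := isPGroup_iff_pow_pow_eq_one.1 hS ⁅s, t⁆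
    have h1 : μ ^ ℓ ^ k = 1 := by
      have h := hv.pow_apply (ℓ ^ k)
      rw [hz, ← map_pow, hk, map_one, End.one_apply] at h
      by_contra h'
      have := sub_ne_zero.2 h'
      apply hv.2
      rw [← smul_right_inj this, sub_smul, ← h, one_smul, sub_self, smul_zero]
    have hmaps : ∀ {x : S}, Commute z (ρ x) → ∀ w ∈ z.eigenspace μ, ρ x w ∈ z.eigenspace μ :=
      fun hx => mapsTo_genEigenspace_of_comm hx μ 1
    have hunit : ∀ (x : S) (hx : Commute z (ρ x)),
        ((ρ x).restrict (hmaps hx)).det ≠ 0 := by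
      intro x hx
      rw [← isUnit_iff_ne_zero]
      apply LinearMap.isUnit_det
      rw [LinearMap.isUnit_iff_ker_eq_bot, LinearMap.ker_eq_bot']
      intro w hw
      have h := congrArg (fun y : z.eigenspace μ => ρ x⁻¹ (y : V)) hw
      simp only [LinearMap.coe_restrict_apply, ZeroMemClass.coe_zero, map_zero] at h
      rw [← End.mul_apply, ← map_mul, inv_mul_cancel, map_one] at h
      exact Subtype.ext h
    have hmul : (ρ s).restrict (hmaps hs) *
        (ρ t).restrict (hmaps ht) =
        μ • ((ρ t).restrict (hmaps ht) *
          (ρ s).restrict (hmaps hs)) := by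
      ext ⟨w, hw⟩
      have hst : ρ s * ρ t = (ρ t * ρ s) * z := by
        rw [← (ht.mul_right hs).eq, hz, ← map_mul, ← map_mul, ← map_mul]
        congr 1
        simp [commutatorElement_def]
      have h := LinearMap.congr_fun hst w
      rw [End.mul_apply (ρ t * ρ s), mem_eigenspace_iff.1 hw, map_smul] at h
      simpa using h
    have hdet := congrArg LinearMap.det hmul
    rw [LinearMap.det_smul, map_mul, map_mul, mul_comm (LinearMap.det _)] at hdet
    have h2 : μ ^ finrank K (z.eigenspace μ) = 1 :=
      (mul_eq_right₀ (mul_ne_zero (hunit t ht) (hunit s hs))).1 hdet.symm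
    have hpos : 0 < finrank K (z.eigenspace μ) :=
      finrank_pos_iff.2 (Submodule.nontrivial_iff_ne_bot.2 hW)
    have hcop : (finrank K (z.eigenspace μ)).Coprime (ℓ ^ k) :=
      (Nat.coprime_of_lt_prime hpos.ne' ((Submodule.finrank_le _).trans_lt hV) hp).symm.pow_right k
    exact hμ (by simpa [hcop.gcd_eq_one] using pow_gcd_eq_one.2 ⟨h2, h1⟩)
  have htop := (hS.isSemisimple_apply hℓ ρ ⁅s, t⁆).iSup_eigenspace_eq_top
  have hle : (⨆ μ, z.eigenspace μ) ≤ z.eigenspace 1 := iSup_le fun μ => by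
    by_cases hμ : μ = 1
    · rw [hμ]
    · rw [hbot μ hμ]; exact bot_le
  rw [htop] at hle
  ext v
  simpa using mem_eigenspace_iff.1 (hle (Submodule.mem_top (x := v)))

/-- An `ℓ`-group is nilpotent. If a term of the lower central series acts trivially, commutators in
the term before act centrally, hence trivially; descend to the derived subgroup. -/
theorem IsPGroup.commute_of_finrank_lt [IsAlgClosed K] [Finite S] (hp : ℓ.Prime)
    (hS : IsPGroup ℓ S) (hℓ : (ℓ : K) ≠ 0) (hV : finrank K V < ℓ) (ρ : S →* End K V) (s t : S) :
    Commute (ρ s) (ρ t) := by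
  have := Fact.mk hp
  have hcomm : ∀ x y : S, ρ ⁅x, y⁆ = 1 → Commute (ρ x) (ρ y) := fun x y h => by
    have : ρ (⁅x, y⁆ * (y * x)) = ρ (y * x) := by rw [map_mul, h, one_mul]
    rw [commutatorElement_def] at this
    rw [Commute, SemiconjBy, ← map_mul, ← map_mul, ← this]
    congr 1
    simp [mul_assoc]
  have key : ∀ n, (⊤ : Subgroup S).lowerCentralSeries (n + 1) ≤ ρ.ker →
      (⊤ : Subgroup S).lowerCentralSeries 1 ≤ ρ.ker := by
    intro n
    induction n with
    | zero => exact id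
    | succ n ih =>
      refine fun h => ih ?_
      rw [Subgroup.lowerCentralSeries_succ, Subgroup.commutator_le]
      intro x hx y hy
      have hz : ∀ w, Commute (ρ ⁅x, y⁆) (ρ w) := fun w => hcomm _ _ <| h <|
        Subgroup.commutator_mem_commutator (Subgroup.commutator_mem_commutator hx hy)
          (Subgroup.mem_top w)
      exact hS.apply_commutator_eq_one hp hℓ hV ρ (hz x) (hz y)
  obtain ⟨n, hn⟩ := Subgroup.nilpotent_iff_lowerCentralSeries.1 hS.isNilpotent
  refine hcomm s t (key n ?_
    (Subgroup.commutator_mem_commutator (Subgroup.mem_top s) (Subgroup.mem_top t)))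
  exact (Subgroup.lowerCentralSeries_antitone _ n.le_succ).trans (hn ▸ bot_le)

/-- If `x` normalizes an `ℓ`-group of operators on a space of dimension `n < ℓ`, then `x ^ n!`
centralizes it. -/
theorem IsPGroup.commute_pow_factorial [IsAlgClosed K] {Γ : Type*} [Group Γ] {S : Subgroup Γ}
    [Finite S] (hp : ℓ.Prime) (hS : IsPGroup ℓ S) (hℓ : (ℓ : K) ≠ 0) {n : ℕ}
    (hV : finrank K V = n) (hn : n < ℓ) (ρ : Γ →* End K V) {x s : Γ}
    (hx : x ∈ Subgroup.normalizer (S : Set Γ)) (hs : s ∈ S) :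
    Commute (ρ (x ^ n.factorial)) (ρ s) := by
  have hss : ∀ t : S, (ρ t).IsSemisimple := hS.isSemisimple_apply hℓ (ρ.comp S.subtype)
  have hcomm : ∀ t u : S, Commute (ρ t) (ρ u) :=
    hS.commute_of_finrank_lt hp hℓ (hV ▸ hn) (ρ.comp S.subtype)
  -- The simultaneous eigenspaces of `S`, whose weights `x` permutes through `σ`.
  set W : (S → K) → Submodule K V := fun χ => ⨅ t : S, (ρ t).maxGenEigenspace (χ t) with hW
  have hmem : ∀ {χ : S → K} {v : V}, v ∈ W χ ↔ ∀ t : S, ρ t v = χ t • v := by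
    intro χ v
    simp only [hW, Submodule.mem_iInf, (hss _).isFinitelySemisimple.maxGenEigenspace_eq_eigenspace,
      mem_eigenspace_iff]
  have htop : ⨆ χ, W χ = ⊤ :=
    iSup_iInf_maxGenEigenspace_eq_top_of_iSup_maxGenEigenspace_eq_top_of_commute
      (fun t : S => ρ t) (fun t u _ => hcomm t u) fun t => iSup_maxGenEigenspace_eq_top _
  have hind : iSupIndep W := independent_iInf_maxGenEigenspace_of_forall_mapsTo
    (fun t : S => ρ t) fun t u μ => mapsTo_maxGenEigenspace_of_comm (hcomm u t) μ
  let c : S ≃ S :=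
    { toFun := fun t => ⟨x⁻¹ * t * x, (Subgroup.mem_normalizer_iff''.1 hx t).1 t.2⟩
      invFun := fun t => ⟨x * t * x⁻¹, (Subgroup.mem_normalizer_iff.1 hx t).1 t.2⟩
      left_inv := fun t => by simp [mul_assoc]
      right_inv := fun t => by simp [mul_assoc] }
  let σ : (S → K) → (S → K) := fun χ => χ ∘ c
  have hσ : Function.Injective σ := c.surjective.injective_comp_right
  have hstep : ∀ {χ : S → K} {v : V}, v ∈ W χ → ρ x v ∈ W (σ χ) := by
    intro χ v hv
    rw [hmem] at hv ⊢
    intro t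
    have h := congrArg (ρ x) (hv (c t))
    rw [map_smul, ← End.mul_apply, ← map_mul] at h
    rw [← End.mul_apply, ← map_mul]
    have hc : x * (c t : Γ) = t * x := by simp [c, mul_assoc]
    rwa [hc] at h
  have hiter : ∀ (m : ℕ) {χ : S → K} {v : V}, v ∈ W χ → ρ (x ^ m) v ∈ W (σ^[m] χ) := by
    intro m
    induction m with
    | zero => simp
    | succ m ih =>
      intro χ v hv
      rw [Function.iterate_succ_apply', pow_succ', map_mul, End.mul_apply]
      exact hstep (ih hv)
  have hinj : ∀ (y : Γ) {v : V}, ρ y v = 0 → v = 0 := by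
    intro y v h
    have h' := congrArg (ρ y⁻¹) h
    rwa [← End.mul_apply, ← map_mul, inv_mul_cancel, map_one, map_zero] at h'
  have hper : ∀ χ, W χ ≠ ⊥ → σ^[n.factorial] χ = χ := by
    intro χ hχ
    obtain ⟨v, hv, hv0⟩ := Submodule.exists_mem_ne_zero_of_ne_bot hχ
    have hne : ∀ m, W (σ^[m] χ) ≠ ⊥ := fun m h =>
      hv0 (hinj (x ^ m) ((Submodule.mem_bot K).1 (h ▸ hiter m hv)))
    let := hind.fintypeNeBotOfFiniteDimensional
    -- At most `n` weights occur, so two of the first `n + 1` iterates of `χ` coincide; the period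
    -- is at most `n` and divides `n!`.
    have hcard : Fintype.card {χ // W χ ≠ ⊥} < Fintype.card (Fin (n + 1)) := by
      rw [Fintype.card_fin, Nat.lt_succ_iff, ← hV]
      exact hind.subtype_ne_bot_le_finrank
    obtain ⟨i, j, hij, h⟩ := Fintype.exists_ne_map_eq_of_card_lt
      (fun i : Fin (n + 1) => (⟨σ^[i] χ, hne i⟩ : {χ // W χ ≠ ⊥})) hcard
    wlog hlt : i < j generalizing i j
    · exact this j i hij.symm h.symm (lt_of_le_of_ne (not_lt.1 hlt) hij.symm)
    have h' : σ^[i] (σ^[j - i] χ) = σ^[i] χ := by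
      rw [← Function.iterate_add_apply, Nat.add_sub_cancel' hlt.le]
      exact (congrArg Subtype.val h).symm
    have hp : Function.IsPeriodicPt σ (j - i) χ := hσ.iterate i h'
    exact hp.trans_dvd (Nat.dvd_factorial (Nat.sub_pos_of_lt hlt)
      ((Nat.sub_le _ _).trans (Nat.lt_succ_iff.1 j.2)))
  have hker : (⊤ : Submodule K V) ≤
      LinearMap.eqLocus (ρ (x ^ n.factorial) * ρ s) (ρ s * ρ (x ^ n.factorial)) := by
    rw [← htop]
    refine iSup_le fun χ v hv => ?_
    by_cases hχ : W χ = ⊥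
    · rw [hχ, Submodule.mem_bot] at hv
      simp [hv]
    · have h1 := hiter n.factorial hv
      rw [hper χ hχ] at h1
      rw [LinearMap.mem_eqLocus, End.mul_apply, End.mul_apply, hmem.1 h1 ⟨s, hs⟩, hmem.1 hv ⟨s, hs⟩,
        map_smul]
  exact LinearMap.ext fun v => hker (Submodule.mem_top (x := v))

end Coprime

/-! ### The kernel at a large new prime -/

open scoped commutatorElement

/-- A form of the Frattini argument. -/
theorem exists_isPGroup_mem_normalizer {Γ Q : Type*} [Group Γ] [Finite Γ] [Group Q] {ℓ : ℕ}
    (hp : ℓ.Prime) {π : Γ →* Q} (hπ : Function.Surjective π) {u : Q} (hu : orderOf u = ℓ)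
    [(Subgroup.zpowers u).Normal] (t : Q) :
    ∃ (S : Subgroup Γ) (s x : Γ), IsPGroup ℓ S ∧ s ∈ S ∧
      x ∈ Subgroup.normalizer (S : Set Γ) ∧ π s = u ∧ π x * u * (π x)⁻¹ = t * u * t⁻¹ := by
  have := Fact.mk hp
  set N : Subgroup Γ := (Subgroup.zpowers u).comap π with hN
  obtain ⟨c, hc⟩ := hπ u
  obtain ⟨a, m, hm, hcm⟩ := Nat.exists_eq_pow_mul_and_not_dvd (orderOf_pos c).ne' ℓ hp.ne_one
  -- Raising to the power `m` leaves an element of `ℓ`-power order; `k`, inverse to `m` modulo `ℓ`,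
  -- makes it lift `u` again.
  obtain ⟨k, -, hk⟩ := Nat.exists_mul_mod_eq_one_of_coprime
    ((Nat.Prime.coprime_iff_not_dvd hp).2 hm).symm hp.one_lt
  have hs : π (c ^ (m * k)) = u := by
    rw [map_pow, hc, ← pow_mod_orderOf, hu, hk, pow_one]
  have hsN : c ^ (m * k) ∈ N := by
    rw [hN, Subgroup.mem_comap, hs]
    exact Subgroup.mem_zpowers u
  have hpow : (⟨c ^ (m * k), hsN⟩ : N) ^ ℓ ^ a = 1 := by
    apply Subtype.ext
    change (c ^ (m * k)) ^ ℓ ^ a = 1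
    rw [← pow_mul, mul_right_comm, mul_comm m, ← hcm, pow_mul, pow_orderOf_eq_one, one_pow]
  have hZ : IsPGroup ℓ (Subgroup.zpowers (⟨c ^ (m * k), hsN⟩ : N)) := by
    refine IsPGroup.of_card_dvd_pow (n := a) ?_
    rw [Nat.card_zpowers]
    exact orderOf_dvd_of_pow_eq_one hpow
  obtain ⟨P, hP⟩ := hZ.exists_le_sylow
  obtain ⟨y, rfl⟩ := hπ t
  have hy : y ∈ Subgroup.normalizer (P.map N.subtype : Set Γ) ⊔ N := by
    rw [Sylow.normalizer_sup_eq_top P]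
    trivial
  obtain ⟨x, hx, n, hn, rfl⟩ := Subgroup.mem_sup_of_normal_right.1 hy
  refine ⟨P.map N.subtype, c ^ (m * k), x, P.2.map _,
    ⟨_, hP (Subgroup.mem_zpowers _), rfl⟩, hx, hs, ?_⟩
  -- The factor `n` maps to a power of `u`, so `x` and `x * n` conjugate `u` alike.
  obtain ⟨i, hi⟩ := Subgroup.mem_zpowers_iff.1 (Subgroup.mem_comap.1 hn)
  rw [map_mul, ← hi]
  group

theorem exists_one_add_nsmul_pow {B : Type*} [Ring B] (c n : ℕ) (Z : B) :
    ∃ W, (1 + c • Z) ^ n = 1 + (n * c) • Z + c ^ 2 • W := by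
  induction n with
  | zero => exact ⟨0, by simp⟩
  | succ n ih =>
    obtain ⟨W, hW⟩ := ih
    refine ⟨n • (Z * Z) + W + c • (W * Z), ?_⟩
    rw [pow_succ, hW]
    simp only [mul_add, add_mul, smul_mul_assoc, mul_smul_comm, one_mul, mul_one, smul_add]
    module

theorem exists_one_add_nsmul_pow_pow {B : Type*} [Ring B] (r n : ℕ) (Z : B) :
    ∃ W, (1 + r • Z) ^ r ^ n = 1 + r ^ (n + 1) • W := by
  induction n with
  | zero => exact ⟨Z, by simp⟩
  | succ n ih =>
    obtain ⟨W, hW⟩ := ih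
    obtain ⟨W', hW'⟩ := exists_one_add_nsmul_pow (r ^ (n + 1)) r W
    refine ⟨W + r ^ n • W', ?_⟩
    rw [pow_succ r n, pow_mul, hW, hW']
    module

namespace Sp

variable {g : ℕ}

theorem map_injective {R S : Type*} [CommRing R] [CommRing S] {f : R →+* S}
    (hf : Function.Injective f) : Function.Injective (Sp.map g f) := fun _ _ h =>
  Subtype.ext (Matrix.map_injective hf (congrArg Subtype.val h))

theorem exists_eq_add_nsmul {d m : ℕ} [NeZero d]
    (A B : Matrix (Fin g ⊕ Fin g) (Fin g ⊕ Fin g) (ZMod d))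
    (h : ∀ i j, m ∣ (A i j - B i j).val) : ∃ Z, A = B + m • Z := by
  choose z hz using h
  refine ⟨Matrix.of fun i j => z i j, ?_⟩
  ext i j
  have := congrArg (Nat.cast (R := ZMod d)) (hz i j)
  rw [ZMod.natCast_zmod_val] at this
  simp [← sub_eq_iff_eq_add', this]

/-- `A` is `1` modulo the radical `r` of `d`, each `r`-th power gains a factor `r`, and `d ∣ r ^ d`.
-/
theorem exists_pow_radical_pow_eq_one {d : ℕ} [NeZero d] (A : Sp g (ZMod d))
    (h : ∀ (p : ℕ) (hp : p ∣ d), p.Prime → Sp.map g (ZMod.castHom hp (ZMod p)) A = 1) :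
    ∃ n, A ^ UniqueFactorizationMonoid.radical d ^ n = 1 := by
  set r := UniqueFactorizationMonoid.radical d with hr
  obtain ⟨Z, hZ⟩ : ∃ Z, A.1 = 1 + r • Z := by
    refine exists_eq_add_nsmul A.1 1 fun i j => ?_
    rw [hr, Nat.radical_eq_prod_primeFactors]
    refine Finset.prod_primes_dvd _ (fun p hp => (Nat.prime_of_mem_primeFactors hp).prime) ?_
    intro p hp
    have hpd := Nat.dvd_of_mem_primeFactors hp
    have h1 := congrFun (congrFun (congrArg Subtype.val
      (h p hpd (Nat.prime_of_mem_primeFactors hp))) i) j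
    rw [← ZMod.natCast_eq_zero_iff, ← map_natCast (ZMod.castHom hpd (ZMod p)),
      ZMod.natCast_zmod_val, map_sub, sub_eq_zero]
    refine h1.trans ?_
    rw [Submonoid.coe_one, one_apply, one_apply, apply_ite (ZMod.castHom hpd (ZMod p)), map_one,
      map_zero]
  obtain ⟨W, hW⟩ := exists_one_add_nsmul_pow_pow r d Z
  refine ⟨d, Subtype.ext ?_⟩
  rw [SubmonoidClass.coe_pow, hZ, hW]
  obtain ⟨c, hc⟩ := (Nat.dvd_radical_pow_self (NeZero.ne d)).trans (pow_dvd_pow r d.le_succ)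
  rw [hc, mul_smul, ← Nat.cast_smul_eq_nsmul (ZMod d) d]
  simp

/-- The symplectic diagonal matrix `diag(a, …, a, a⁻¹, …, a⁻¹)`. -/
def torus {R : Type*} [CommRing R] (a : Rˣ) : Sp g R :=
  ⟨fromBlocks ((a : R) • 1) 0 0 ((↑a⁻¹ : R) • 1), by
    rw [SymplecticGroup.fromBlocks_mem_iff]
    simp [smul_smul]⟩

theorem torus_conj_transvection {R : Type*} [CommRing R] (a : Rˣ) (i : Fin g) (c : R) :
    torus a * transvection (Pi.single (Sum.inl i) 1) c * (torus a)⁻¹ =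
      transvection (Pi.single (Sum.inl i) 1) (a ^ 2 * c) := by
  have hv : (torus a : Sp g R).1 *ᵥ Pi.single (Sum.inl i) 1 =
      (a : R) • Pi.single (Sum.inl i) 1 := by
    ext j
    rcases j with j | j <;> simp [torus, one_apply, Pi.single_apply]
  rw [conj_transvection, hv]
  apply Subtype.ext
  simp [rankOne, smul_smul, vecMulVec_smul, smul_vecMulVec, mul_comm, pow_two]

theorem transvection_eq_one_iff {R : Type*} [CommRing R] (i : Fin g) (c : R) :
    transvection (Pi.single (Sum.inl i) 1) c = 1 ↔ c = 0 := by
  refine ⟨fun h => ?_, fun h => by simp [h]⟩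
  have h1 : (transvection (Pi.single (Sum.inl i) 1) c).1 *ᵥ Pi.single (Sum.inr i) 1 =
    Pi.single (Sum.inr i) 1 := by rw [h, Submonoid.coe_one, one_mulVec]
  rw [transvection_mulVec] at h1
  have h2 := congrFun h1 (Sum.inl i)
  simpa [form, J, mulVec_single_one, dotProduct, Pi.single_apply, one_apply] using h2

/-- The action of the symplectic group on the standard representation over an extension. -/
def toEnd (g : ℕ) {R K : Type*} [CommRing R] [CommRing K] (f : R →+* K) :
    Sp g R →* Module.End K (Fin g ⊕ Fin g → K) :=
  (Matrix.toLinAlgEquiv' (R := K) (n := Fin g ⊕ Fin g)).toAlgHom.toMonoidHom.comp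
    ((symplecticGroup (Fin g) K).subtype.comp (Sp.map g f))

theorem toEnd_injective {R K : Type*} [CommRing R] [CommRing K] {f : R →+* K}
    (hf : Function.Injective f) : Function.Injective (toEnd g f) := fun _ _ h =>
  map_injective hf (Subtype.ext (Matrix.toLinAlgEquiv'.injective h))

/-- The unit group is cyclic of order `q - 1 > n`. -/
theorem exists_unit_pow_ne_one {q : ℕ} [Fact q.Prime] {n : ℕ} (hn : 0 < n) (hq : n + 1 < q) :
    ∃ a : (ZMod q)ˣ, a ^ n ≠ 1 := by
  obtain ⟨a, ha⟩ := IsCyclic.exists_generator (α := (ZMod q)ˣ)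
  refine ⟨a, fun h => ?_⟩
  have h1 := Nat.le_of_dvd hn (orderOf_dvd_of_pow_eq_one h)
  rw [orderOf_eq_card_of_forall_mem_zpowers ha, Nat.card_eq_fintype_card, ZMod.card_units] at h1
  omega

theorem transvection_mem_zpowers {q : ℕ} [NeZero q] (v : Fin g ⊕ Fin g → ZMod q) (c : ZMod q) :
    transvection v c ∈ Subgroup.zpowers (transvection v 1) := by
  refine ⟨c.val, ?_⟩
  simp only [zpow_natCast, transvection_pow, ZMod.natCast_zmod_val, mul_one]

theorem pow_conj_transvection {R : Type*} [CommRing R] (x : Sp g R) (a : R)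
    (v : Fin g ⊕ Fin g → R) (h : ∀ c, x * transvection v c * x⁻¹ = transvection v (a * c))
    (n : ℕ) (c : R) : x ^ n * transvection v c * (x ^ n)⁻¹ = transvection v (a ^ n * c) := by
  induction n with
  | zero => simp
  | succ n ih =>
    rw [pow_succ' x, _root_.mul_inv_rev, pow_succ', mul_assoc a, ← h, ← ih]
    group

theorem conj_transvection_of_one {q : ℕ} [NeZero q] {x : Sp g (ZMod q)} {a : ZMod q}
    {v : Fin g ⊕ Fin g → ZMod q} (h : x * transvection v 1 * x⁻¹ = transvection v a) (c : ZMod q) :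
    x * transvection v c * x⁻¹ = transvection v (a * c) := by
  have h1 := congrArg (· ^ c.val) h
  simpa only [conj_pow, transvection_pow, ZMod.natCast_zmod_val, mul_one, mul_comm] using h1

/-- Let a finite group map onto `Sp_{2g}(𝔽_q)` and to `Sp_{2g}(ℤ/d)`. If `q` does not divide `d` and
is large in terms of `g`, the kernel of the second map still maps onto `Sp_{2g}(𝔽_q)`. -/
theorem map_ker_eq_top (hg : 1 ≤ g) {d q : ℕ} [NeZero d] (hq : q.Prime) (hqd : ¬ q ∣ d)
    (hbig : 2 * (2 * g).factorial + 1 < q) {Γ : Type*} [Group Γ] [Finite Γ]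
    (ρ : Γ →* Sp g (ZMod d)) {π : Γ →* Sp g (ZMod q)} (hπ : Function.Surjective π) :
    ρ.ker.map π = ⊤ := by
  have := Fact.mk hq
  have hnormal : (ρ.ker.map π).Normal := Subgroup.Normal.map inferInstance π hπ
  set i : Fin g := ⟨0, hg⟩
  set v : Fin g ⊕ Fin g → ZMod q := Pi.single (Sum.inl i) 1 with hv
  have hv0 : v ≠ 0 := by simp [hv]
  set K := (2 * g).factorial with hK
  have hKpos : 0 < K := Nat.factorial_pos _
  suffices h : ∃ c, c ≠ 0 ∧ transvection v c ∈ ρ.ker.map π by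
    obtain ⟨c, hc, hmem⟩ := h
    refine eq_top_of_normal _ hv0 fun e => ?_
    have h1 := pow_mem hmem (e / c).val
    rwa [transvection_pow, ZMod.natCast_zmod_val, div_mul_cancel₀ _ hc] at h1
  obtain ⟨a, ha⟩ := exists_unit_pow_ne_one (q := q) (n := 2 * K) (by omega) hbig
  set u : Sp g (ZMod q) := transvection v 1 with hu
  -- Inside this normalizer `⟨u⟩` is normal, as the Frattini argument requires; the torus belongs to
  -- it.
  set Q : Subgroup (Sp g (ZMod q)) := Subgroup.normalizer (Subgroup.zpowers u : Set _) with hQ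
  have huQ : u ∈ Q := Subgroup.le_normalizer (Subgroup.mem_zpowers u)
  have htQ : torus a ∈ Q := by
    refine Subgroup.mem_normalizer_fintype ?_
    rintro _ ⟨k, rfl⟩
    obtain ⟨c, hc⟩ : ∃ c, u ^ k = transvection v c := by
      obtain ⟨m, hm⟩ := (isOfFinOrder_of_finite u).mem_powers_iff_mem_zpowers.2 ⟨k, rfl⟩
      exact ⟨_, hm.symm.trans (transvection_pow v 1 m)⟩
    simp only [hc]
    rw [hv, torus_conj_transvection]
    exact transvection_mem_zpowers _ _
  have hord : orderOf (⟨u, huQ⟩ : Q) = q := by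
    rw [← Subgroup.orderOf_coe]
    refine orderOf_eq_prime ?_ ?_
    · change u ^ q = 1
      rw [hu, transvection_pow]; simp
    · change u ≠ 1
      rw [hu, Ne, transvection_eq_one_iff]; exact one_ne_zero
  have hnorm : (Subgroup.zpowers (⟨u, huQ⟩ : Q)).Normal := by
    have h : Subgroup.zpowers (⟨u, huQ⟩ : Q) = (Subgroup.zpowers u).subgroupOf Q := by
      apply Subgroup.map_injective Q.subtype_injective
      rw [MonoidHom.map_zpowers, Subgroup.subgroupOf_map_subtype, inf_eq_left.2]
      · rfl
      · exact Subgroup.le_normalizer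
    rw [h]
    exact Subgroup.normal_in_normalizer
  obtain ⟨S, s, x, hS, hs, hx, hsu, hxu⟩ := exists_isPGroup_mem_normalizer hq
    (MonoidHom.subgroupComap_surjective_of_surjective π Q hπ) hord (⟨torus a, htQ⟩ : Q)
  replace hsu : π s = u := congrArg Subtype.val hsu
  replace hxu : π x * u * (π x)⁻¹ = torus a * u * (torus a)⁻¹ := congrArg Subtype.val hxu
  rw [hu, hv, torus_conj_transvection, mul_one, ← hv] at hxu
  have hfin : Finite S := inferInstance
  obtain ⟨n, hn⟩ := exists_pow_radical_pow_eq_one (ρ ⁅(x : Γ) ^ K, (s : Γ)⁆) (by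
    intro p hpd hp
    have := Fact.mk hp
    have hqp : (q : AlgebraicClosure (ZMod p)) ≠ 0 := by
      rw [Ne, CharP.cast_eq_zero_iff _ p, Nat.prime_dvd_prime_iff_eq hp hq]
      rintro rfl
      exact hqd hpd
    have hcomm := hS.commute_pow_factorial hq hqp (n := 2 * g) (by simp [two_mul])
      (by have := Nat.self_le_factorial (2 * g); omega)
      ((toEnd g (algebraMap (ZMod p) (AlgebraicClosure (ZMod p)))).comp
        ((Sp.map g (ZMod.castHom hpd (ZMod p))).comp (ρ.comp (Q.comap π).subtype))) hx hs
    rw [Commute, SemiconjBy, ← map_mul, ← map_mul] at hcomm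
    have h1 := toEnd_injective (FaithfulSMul.algebraMap_injective _ _) hcomm
    simp only [MonoidHom.comp_apply, Subgroup.subtype_apply, map_mul,
      Subgroup.coe_pow] at h1
    rw [← hK] at h1
    rw [commutatorElement_def]
    simp only [map_mul, map_inv]
    rw [h1, mul_inv_cancel_right, mul_inv_cancel])
  set r := UniqueFactorizationMonoid.radical d ^ n with hr
  -- Modulo `q`, conjugation by `x ^ K` scales the transvection `u` by `a ^ (2 * K)`, so the
  -- commutator has coefficient `a ^ (2 * K) - 1`.
  refine ⟨(r : ZMod q) * ((a : ZMod q) ^ (2 * K) - 1), mul_ne_zero ?_ ?_,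
    (⁅(x : Γ) ^ K, (s : Γ)⁆) ^ r, ?_, ?_⟩
  · rw [Ne, ZMod.natCast_eq_zero_iff]
    intro h
    exact hqd ((hq.dvd_of_dvd_pow h).trans (UniqueFactorizationMonoid.radical_dvd_self))
  · rw [sub_ne_zero]
    exact fun h => ha (Units.ext (by simpa using h))
  · rw [SetLike.mem_coe, MonoidHom.mem_ker, map_pow, hn]
  · have h1 := pow_conj_transvection (π x) _ v (conj_transvection_of_one hxu) K 1
    rw [map_pow, commutatorElement_def, map_mul, map_mul, map_mul, map_inv, map_inv, map_pow, hsu,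
      hu, h1, transvection_inv, ← transvection_add, transvection_pow]
    congr 1
    ring

end Sp

/-! ### Kernels of reduction at a repeated prime -/

/-- If `E ^ 2 = 0`, the `q`-th power of a perturbation of `1 + a E` modulo `a q` is `1 + a q E`
modulo `a q ^ 2`. -/
theorem pow_prime_eq_one_add_nsmul {B : Type*} [Ring B] {a q : ℕ} (hq : q.Prime)
    (hB : ∀ X : B, (a * q * q) • X = 0) (haq : 5 ≤ q ∨ q ∣ a) {E : B} (hE : E * E = 0) (Z : B) :
    (1 + a • E + (a * q) • Z) ^ q = 1 + (a * q) • E := by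
  set D := E + q • Z with hD
  set F := E * Z + Z * E + q • (Z * Z) with hF
  have hD2 : D ^ 2 = q • F := by
    rw [hD, hF, pow_two]
    simp only [mul_add, add_mul, smul_mul_assoc, mul_smul_comm, hE]
    module
  have hzero : ∀ {n : ℕ} (X : B), a * q * q ∣ n → n • X = 0 := by
    rintro _ X ⟨k, rfl⟩
    rw [mul_smul, hB]
  have hsum : 1 + a • E + (a * q) • Z = a • D + 1 := by rw [hD]; module
  rw [hsum, (Commute.one_right (a • D)).add_pow, ← Finset.sum_subset (Finset.range_mono
    (show 2 ≤ q + 1 by have := hq.two_le; omega))]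
  · have h1 : (a * q) • D = (a * q) • E := by
      rw [hD, smul_add, smul_smul, hB, add_zero]
    rw [Finset.sum_range_succ, Finset.sum_range_one]
    simp only [pow_zero, one_pow, mul_one, Nat.choose_zero_right, Nat.cast_one, pow_one,
      Nat.choose_one_right]
    rw [← nsmul_eq_mul', smul_smul, mul_comm q a, h1]
  -- Terms with `2 ≤ m < q` get one `q` from the binomial coefficient and one from `D ^ 2 = q F`.
  -- For `m = q` the second `q` comes from `D ^ 4` or from `q ∣ a`.
  · intro m hm hm'
    rw [Finset.mem_range] at hm hm'
    have hm2 : 2 ≤ m := not_lt.1 hm'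
    have ham : a ∣ a ^ m := dvd_pow_self a (by omega)
    have hDm : D ^ m = q • (F * D ^ (m - 2)) := by
      rw [← Nat.add_sub_cancel' hm2, pow_add, hD2, smul_mul_assoc, Nat.add_sub_cancel_left]
    rw [one_pow, mul_one, ← nsmul_eq_mul', smul_pow, smul_smul]
    rcases (Nat.lt_succ_iff.1 hm).lt_or_eq with hlt | rfl
    · rw [hDm, smul_smul]
      apply hzero
      rw [mul_comm (q.choose m)]
      exact mul_dvd_mul (mul_dvd_mul ham (hq.dvd_choose_self (by omega) hlt)) dvd_rfl
    · rw [Nat.choose_self, one_mul]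
      rcases haq with h5 | hdvd
      · have hD4 : D ^ m = (m * m) • (F * F * D ^ (m - 4)) := by
          have h4 : D ^ 4 = (m * m) • (F * F) := by
            rw [show 4 = 2 + 2 from rfl, pow_add, hD2, smul_mul_assoc, mul_smul_comm, smul_smul]
          conv_lhs => rw [← Nat.add_sub_cancel' (show 4 ≤ m by omega), pow_add, h4, smul_mul_assoc]
        rw [hD4, smul_smul]
        apply hzero
        rw [mul_assoc]
        exact mul_dvd_mul ham dvd_rfl
      · rw [hDm, smul_smul]
        apply hzero
        refine mul_dvd_mul ?_ dvd_rfl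
        obtain ⟨k, hk⟩ := Nat.exists_eq_add_of_le hm2
        rw [hk, pow_add, pow_two, ← hk, mul_assoc]
        exact mul_dvd_mul dvd_rfl (hdvd.mul_right _)

namespace Sp

variable {g : ℕ}

section

variable {R : Type*} [CommRing R]

/-- The matrices `Y` such that `1 + e Y J` lies in `H`, where `e ^ 2 = 0`. -/
def infinitesimal (H : Subgroup (Sp g R)) (e : R) (he : e * e = 0) :
    AddSubmonoid (Matrix (Fin g ⊕ Fin g) (Fin g ⊕ Fin g) R) where
  carrier := {Y | ∃ h ∈ H, h.1 = 1 + e • (Y * J (Fin g) R)}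
  zero_mem' := ⟨1, one_mem H, by simp⟩
  add_mem' := by
    rintro Y Y' ⟨h, hh, hY⟩ ⟨h', hh', hY'⟩
    refine ⟨h * h', mul_mem hh hh', ?_⟩
    rw [Submonoid.coe_mul, hY, hY']
    simp only [mul_add, add_mul, Matrix.smul_mul, Matrix.mul_smul, smul_smul, he, zero_smul,
      one_mul, mul_one, smul_add]
    abel

/-- Polarization, with no division by `2`: the squares `v vᵀ` yield the diagonal units and the sums
`E_ij + E_ji`. -/
theorem mem_infinitesimal_of_isSymm {H : Subgroup (Sp g R)} {e : R} (he : e * e = 0)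
    (hH : ∀ v c, transvection v (e * c) ∈ H) {Y : Matrix (Fin g ⊕ Fin g) (Fin g ⊕ Fin g) R}
    (hY : Y.IsSymm) : Y ∈ infinitesimal H e he := by
  have hv : ∀ v c, c • vecMulVec v v ∈ infinitesimal H e he := fun v c =>
    ⟨_, hH v c, by rw [coe_transvection, rankOne, Matrix.smul_mul, smul_smul]⟩
  have hdiag : ∀ i c, Matrix.single i i c ∈ infinitesimal H e he := fun i c => by
    have := hv (Pi.single i 1) c
    rwa [← Matrix.single_eq_single_vecMulVec_single, Matrix.smul_single, smul_eq_mul, mul_one]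
      at this
  have hoff : ∀ i j c, Matrix.single i j c + Matrix.single j i c ∈ infinitesimal H e he := by
    intro i j c
    have := add_mem (hv (Pi.single i 1 + Pi.single j 1) c) (add_mem (hdiag i (-c)) (hdiag j (-c)))
    convert! this using 1
    simp only [add_vecMulVec, vecMulVec_add, ← Matrix.single_eq_single_vecMulVec_single, smul_add,
      Matrix.smul_single, smul_eq_mul, mul_one, ← Matrix.single_neg]
    abel
  let r := Fintype.equivFin (Fin g ⊕ Fin g)
  let U : Matrix (Fin g ⊕ Fin g) (Fin g ⊕ Fin g) R :=
    Matrix.of fun i j => if r i < r j then Y i j else 0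
  have hYU : Y = Matrix.diagonal (fun i => Y i i) + (U + Uᵀ) := by
    ext i j
    rcases lt_trichotomy (r i) (r j) with h | h | h
    · have hij : i ≠ j := fun h' => h.ne (congrArg r h')
      simp [U, h, h.not_gt, hij]
    · have hij : i = j := r.injective h
      simp [U, hij]
    · have hij : i ≠ j := fun h' => h.ne' (congrArg r h')
      simp [U, h, h.not_gt, hij, hY.apply i j]
  have hUsum : U + Uᵀ = ∑ i, ∑ j, (Matrix.single i j (U i j) + Matrix.single j i (U i j)) := by
    conv_lhs => rw [Matrix.matrix_eq_sum_single U]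
    simp [Matrix.transpose_sum, Finset.sum_add_distrib]
  rw [hYU, hUsum, ← Matrix.sum_single_eq_diagonal]
  exact add_mem (sum_mem fun i _ => hdiag i _) (sum_mem fun i _ => sum_mem fun j _ => hoff i j _)

/-- The kernel of reduction modulo an element of square zero is generated by transvections. -/
theorem mem_of_eq_one_add_smul {H : Subgroup (Sp g R)} {e : R} (he : e * e = 0)
    (hH : ∀ v c, transvection v (e * c) ∈ H) {A : Sp g R}
    {X : Matrix (Fin g ⊕ Fin g) (Fin g ⊕ Fin g) R} (hA : A.1 = 1 + e • X) : A ∈ H := by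
  set Y := -(X * J (Fin g) R) with hY
  have hXY : X = Y * J (Fin g) R := by
    rw [hY, Matrix.neg_mul, Matrix.mul_assoc, J_squared, Matrix.mul_neg, Matrix.mul_one, neg_neg]
  have hsymm : e • Yᵀ = e • Y := by
    have h := SymplecticGroup.mem_iff.1 A.2
    rw [hA] at h
    simp only [transpose_add, transpose_one, transpose_smul, add_mul, mul_add, Matrix.one_mul,
      Matrix.mul_one, Matrix.smul_mul, Matrix.mul_smul, smul_smul, he, zero_smul, add_zero] at h
    rw [add_assoc, add_eq_left] at h
    rw [hY, transpose_neg, transpose_mul, J_transpose, Matrix.neg_mul, neg_neg, smul_neg]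
    exact eq_neg_of_add_eq_zero_right h
  let r := Fintype.equivFin (Fin g ⊕ Fin g)
  -- Only `e • Y` is known to be symmetric; mirroring one triangle gives a symmetric matrix with the
  -- same multiple by `e`.
  let Y' : Matrix (Fin g ⊕ Fin g) (Fin g ⊕ Fin g) R :=
    Matrix.of fun i j => if r i ≤ r j then Y i j else Y j i
  have hY's : Y'.IsSymm := by
    ext i j
    rcases lt_trichotomy (r i) (r j) with h | h | h
    · simp [Y', h.le, h.not_ge]
    · simp [Y', r.injective h]
    · simp [Y', h.le, h.not_ge]
  have hY'Y : e • Y' = e • Y := by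
    ext i j
    by_cases h : r i ≤ r j
    · simp [Y', h]
    · simpa [Y', h] using congrFun (congrFun hsymm i) j
  obtain ⟨h, hh, hY'⟩ := mem_infinitesimal_of_isSymm he hH hY's
  convert! hh
  apply Subtype.ext
  rw [hA, hY', hXY, ← Matrix.smul_mul, ← Matrix.smul_mul, hY'Y]

end

end Sp

/-! ### Congruences and the profinite topology -/

open scoped Topology in
/-- If the classes of a family of relations refine the neighbourhoods in `X`, the classes of the
pointwise relations refine the neighbourhoods in a finite power of `X`. -/
theorem exists_forall_mem_of_mem_nhds_pi {X ι : Type*} [TopologicalSpace X] [Finite ι]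
    {r : ℕ+ → X → X → Prop} (hr : ∀ m n : ℕ+, (m : ℕ) ∣ n → ∀ x y, r n x y → r m x y)
    (h : ∀ x, ∀ V ∈ 𝓝 x, ∃ n, ∀ y, r n x y → y ∈ V) (x : ι → X) :
    ∀ V ∈ 𝓝 x, ∃ n, ∀ y : ι → X, (∀ i, r n (x i) (y i)) → y ∈ V := by
  intro V hV
  have := Fintype.ofFinite ι
  rw [nhds_pi, Filter.mem_pi'] at hV
  obtain ⟨I, t, ht, hV⟩ := hV
  choose n hn using fun i => h (x i) (t i) (ht i)
  refine ⟨∏ i, n i, fun y hy => hV fun i _ => hn i _ (hr _ _ ?_ _ _ (hy i))⟩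
  exact PNat.dvd_iff.1 (Finset.dvd_prod_of_mem n (Finset.mem_univ i))

namespace ProfiniteInt

open scoped Topology in
theorem exists_forall_mem_of_mem_nhds (x : ProfiniteInt) :
    ∀ V ∈ 𝓝 x, ∃ n : ℕ+, ∀ y, toZMod n x = toZMod n y → y ∈ V := by
  intro V hV
  rw [nhds_subtype, Filter.mem_comap] at hV
  obtain ⟨W, hW, hV⟩ := hV
  rw [nhds_pi, Filter.mem_pi'] at hW
  obtain ⟨I, t, ht, hW⟩ := hW
  refine ⟨∏ n ∈ I, n, fun y hy => hV (hW fun n hn => ?_)⟩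
  have hdvd : (n : ℕ) ∣ (∏ n ∈ I, n : ℕ+) := PNat.dvd_iff.1 (Finset.dvd_prod_of_mem _ hn)
  have h := congrArg (ZMod.castHom hdvd (ZMod n)) hy
  have hx := x.2 n _ hdvd
  have hy' := y.2 n _ hdvd
  change ZMod.castHom hdvd (ZMod n) (x.1 _) = ZMod.castHom hdvd (ZMod n) (y.1 _) at h
  rw [hx, hy'] at h
  rw [← h]
  exact mem_of_mem_nhds (ht n)

theorem castHom_comp_toZMod {m n : ℕ+} (h : (m : ℕ) ∣ n) :
    (ZMod.castHom h (ZMod m)).comp (toZMod n) = toZMod m :=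
  RingHom.ext fun x => x.2 m n h

end ProfiniteInt

namespace Sp

variable {g : ℕ}

/-- Reduction modulo `n` on `Sp_{2g}(Ẑ)`. -/
abbrev red (g : ℕ) (n : ℕ+) : Sp g ProfiniteInt →* Sp g (ZMod n) :=
  Sp.map g (ProfiniteInt.toZMod n)

theorem map_castHom_red {m n : ℕ+} (h : (m : ℕ) ∣ n) (A : Sp g ProfiniteInt) :
    Sp.map g (ZMod.castHom h (ZMod m)) (red g n A) = red g m A := by
  rw [map_comp, ProfiniteInt.castHom_comp_toZMod]

theorem red_eq_of_dvd {m n : ℕ+} (h : (m : ℕ) ∣ n) {A B : Sp g ProfiniteInt}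
    (hAB : red g n A = red g n B) : red g m A = red g m B := by
  rw [← map_castHom_red h, hAB, map_castHom_red]

/-- Reductions modulo positive integers define the topology of `Sp_{2g}(Ẑ)`. -/
theorem exists_forall_red_eq_mem {U : Set (Sp g ProfiniteInt)} (hU : IsOpen U)
    {A : Sp g ProfiniteInt} (hA : A ∈ U) : ∃ n : ℕ+, ∀ B, red g n A = red g n B → B ∈ U := by
  have hV := hU.mem_nhds hA
  rw [nhds_subtype, Filter.mem_comap] at hV
  obtain ⟨V, hV, hVU⟩ := hV
  have hcast : ∀ m n : ℕ+, (m : ℕ) ∣ n → ∀ x y : ProfiniteInt,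
      ProfiniteInt.toZMod n x = ProfiniteInt.toZMod n y →
        ProfiniteInt.toZMod m x = ProfiniteInt.toZMod m y := fun m n h x y hxy => by
    rw [← ProfiniteInt.castHom_comp_toZMod h, RingHom.comp_apply, hxy, RingHom.comp_apply]
  -- A matrix is a family of rows, so the lemma on powers is used twice.
  obtain ⟨n, hn⟩ := exists_forall_mem_of_mem_nhds_pi (ι := Fin g ⊕ Fin g)
    (r := fun n (x y : Fin g ⊕ Fin g → ProfiniteInt) =>
      ∀ i, ProfiniteInt.toZMod n (x i) = ProfiniteInt.toZMod n (y i))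
    (fun m n h x y hxy i => hcast m n h _ _ (hxy i))
    (exists_forall_mem_of_mem_nhds_pi hcast ProfiniteInt.exists_forall_mem_of_mem_nhds) A.1 V hV
  exact ⟨n, fun B hB => hVU (hn B.1 fun i j => congrFun (congrFun (congrArg Subtype.val hB) i) j)⟩

/-! ### Lifting from level `d` to level `d * q` -/

/-- The free factor `k` is for placing the lift in a congruence subgroup: if `N ∣ k`, it is trivial
modulo `N`. -/
theorem exists_red_transvection (n : ℕ+) (v : Fin g ⊕ Fin g → ZMod n) (c : ZMod n) :
    ∃ (w : Fin g ⊕ Fin g → ProfiniteInt) (e : ProfiniteInt), ∀ k : ℕ,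
      red g n (transvection w (k * e)) = transvection v (k * c) := by
  refine ⟨fun i => ((v i).val : ProfiniteInt), (c.val : ProfiniteInt), fun k => ?_⟩
  rw [map_transvection, map_mul, map_natCast, map_natCast, ZMod.natCast_zmod_val]
  congr 1
  ext i
  simp

theorem red_transvection_natCast_mul {n : ℕ+} {k : ℕ} (h : (n : ℕ) ∣ k)
    (w : Fin g ⊕ Fin g → ProfiniteInt) (e : ProfiniteInt) :
    red g n (transvection w (k * e)) = 1 := by
  rw [map_transvection, map_mul, map_natCast, (ZMod.natCast_eq_zero_iff _ _).2 h, zero_mul,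
    transvection_zero]

theorem exists_eq_add_nsmul_of_map_eq {d n : ℕ} [NeZero n] (h : d ∣ n) {A B : Sp g (ZMod n)}
    (hAB : Sp.map g (ZMod.castHom h (ZMod d)) A = Sp.map g (ZMod.castHom h (ZMod d)) B) :
    ∃ Z, A.1 = B.1 + d • Z := by
  refine exists_eq_add_nsmul A.1 B.1 fun i j => ?_
  rw [← ZMod.natCast_eq_zero_iff, ← map_natCast (ZMod.castHom h (ZMod d)), ZMod.natCast_zmod_val,
    map_sub, sub_eq_zero]
  exact congrFun (congrFun (congrArg Subtype.val hAB) i) j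

theorem eq_of_map_eq_of_coprime {d q n : ℕ} (hn : n = d * q) (hd : d ∣ n) (hq : q ∣ n)
    (hdq : d.Coprime q) [NeZero n] {A B : Sp g (ZMod n)}
    (h1 : Sp.map g (ZMod.castHom hd (ZMod d)) A = Sp.map g (ZMod.castHom hd (ZMod d)) B)
    (h2 : Sp.map g (ZMod.castHom hq (ZMod q)) A = Sp.map g (ZMod.castHom hq (ZMod q)) B) :
    A = B := by
  have key : ∀ {m : ℕ} (h : m ∣ n),
      Sp.map g (ZMod.castHom h (ZMod m)) A = Sp.map g (ZMod.castHom h (ZMod m)) B →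
      ∀ i j, m ∣ (A.1 i j - B.1 i j).val := fun {m} h hAB i j => by
    rw [← ZMod.natCast_eq_zero_iff, ← map_natCast (ZMod.castHom h (ZMod m)),
      ZMod.natCast_zmod_val, map_sub, sub_eq_zero]
    exact congrFun (congrFun (congrArg Subtype.val hAB) i) j
  ext i j
  rw [← sub_eq_zero, ← ZMod.natCast_zmod_val (A.1 i j - B.1 i j), ZMod.natCast_eq_zero_iff]
  nth_rw 1 [hn]
  exact hdq.mul_dvd_of_dvd_of_dvd (key hd h1 i j) (key hq h2 i j)

theorem red_mem_map_of_prime_dvd {G H : Subgroup (Sp g ProfiniteInt)} {N d q n : ℕ+}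
    (hG : ∀ A, red g N A = 1 → A ∈ G) (hq : (q : ℕ).Prime) (hn : (n : ℕ) = d * q)
    {a : ℕ} (hda : (d : ℕ) = a * q) (hNa : (N : ℕ) ∣ a) (haq : 5 ≤ (q : ℕ) ∨ (q : ℕ) ∣ a)
    (hGH : ∀ A ∈ G, ∃ h ∈ H, red g d h = red g d A) {B : Sp g ProfiniteInt}
    (hB : red g d B = 1) : red g n B ∈ H.map (red g n) := by
  have hdn : (d : ℕ) ∣ n := hn ▸ dvd_mul_right _ _
  have hee : ((d : ℕ) : ZMod n) * ((d : ℕ) : ZMod n) = 0 := by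
    rw [← Nat.cast_mul, ZMod.natCast_eq_zero_iff, hn]
    exact mul_dvd_mul dvd_rfl (hda ▸ dvd_mul_left _ _)
  rw [← map_one (red g d), ← map_castHom_red hdn, ← map_castHom_red hdn] at hB
  obtain ⟨X, hX⟩ := exists_eq_add_nsmul_of_map_eq hdn hB
  rw [map_one, Submonoid.coe_one, ← Nat.cast_smul_eq_nsmul (ZMod n)] at hX
  refine mem_of_eq_one_add_smul hee (fun v c => ?_) hX
  obtain ⟨w, e, hwe⟩ := exists_red_transvection n v c
  obtain ⟨h, hh, hhd⟩ := hGH _ (hG _ (red_transvection_natCast_mul hNa w e))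
  rw [← map_castHom_red hdn, ← map_castHom_red hdn] at hhd
  obtain ⟨Z, hZ⟩ := exists_eq_add_nsmul_of_map_eq hdn hhd
  refine ⟨h ^ (q : ℕ), pow_mem hh _, Subtype.ext ?_⟩
  have hE : (c • rankOne v) * (c • rankOne v) = 0 := by
    rw [smul_mul_smul_comm, rankOne_mul_self, smul_zero]
  have := pow_prime_eq_one_add_nsmul (a := a) hq (fun X => by
    rw [← hda, ← hn, ← Nat.cast_smul_eq_nsmul (ZMod n) (n : ℕ), ZMod.natCast_self, zero_smul])
    haq hE Z
  rw [map_pow, SubmonoidClass.coe_pow, hZ, hwe, coe_transvection, coe_transvection, mul_smul,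
    mul_smul, Nat.cast_smul_eq_nsmul, Nat.cast_smul_eq_nsmul, hda, this]

/-- By `map_ker_eq_top` applied to the image of `H` modulo `n`, some element there is trivial modulo
`d` and equals `B` modulo `q`; the Chinese remainder theorem identifies it with `B`. -/
theorem red_mem_map_of_prime_not_dvd (hg : 1 ≤ g) {H : Subgroup (Sp g ProfiniteInt)} {d q n : ℕ+}
    (hq : (q : ℕ).Prime) (hn : (n : ℕ) = d * q) (hqd : ¬ (q : ℕ) ∣ d)
    (hbig : 2 * (2 * g).factorial + 1 < (q : ℕ)) (hH : modReduction H q = ⊤)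
    {B : Sp g ProfiniteInt} (hB : red g d B = 1) : red g n B ∈ H.map (red g n) := by
  have hdn : (d : ℕ) ∣ n := hn ▸ dvd_mul_right _ _
  have hqn : (q : ℕ) ∣ n := hn ▸ dvd_mul_left _ _
  have hker := map_ker_eq_top hg hq hqd hbig
    ((Sp.map g (ZMod.castHom hdn (ZMod d))).comp (H.map (red g n)).subtype)
    (π := (Sp.map g (ZMod.castHom hqn (ZMod q))).comp (H.map (red g n)).subtype) (by
      intro A
      obtain ⟨h, hh, rfl⟩ : A ∈ modReduction H q := hH ▸ Subgroup.mem_top A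
      exact ⟨⟨red g n h, h, hh, rfl⟩, map_castHom_red hqn h⟩)
  obtain ⟨x, hx, hxB⟩ : red g q B ∈ Subgroup.map _ _ := hker ▸ Subgroup.mem_top (red g q B)
  have : red g n B = x := by
    refine eq_of_map_eq_of_coprime hn hdn hqn (hq.coprime_iff_not_dvd.2 hqd).symm ?_ ?_
    · rw [map_castHom_red, hB]
      exact (MonoidHom.mem_ker.1 hx).symm
    · rw [map_castHom_red]
      exact hxB.symm
  rw [this]
  exact x.2

/-- A subgroup containing a principal congruence subgroup of level `N` surjects onto the symplectic
group modulo every prime not dividing `N`. -/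
theorem modReduction_eq_top {G : Subgroup (Sp g ProfiniteInt)} {N q : ℕ+}
    (hG : ∀ A, red g N A = 1 → A ∈ G) (hq : (q : ℕ).Prime) (hqN : ¬ (q : ℕ) ∣ N) :
    modReduction G q = ⊤ := by
  have := Fact.mk hq
  refine eq_top_of_transvection_mem _ fun v c => ?_
  have hN : ((N : ℕ) : ZMod q) ≠ 0 := by rwa [Ne, ZMod.natCast_eq_zero_iff]
  obtain ⟨w, e, hwe⟩ := exists_red_transvection q v (((N : ℕ) : ZMod q)⁻¹ * c)
  refine ⟨_, hG _ (red_transvection_natCast_mul dvd_rfl w e), ?_⟩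
  rw [hwe, mul_inv_cancel_left₀ hN]

/-- The induction on the level: a subgroup `H` with the right reductions has the same reduction as
`G` modulo every multiple of `N ^ 2`. -/
theorem exists_red_eq_of_modReduction_eq (hg : 1 ≤ g) {G H : Subgroup (Sp g ProfiniteInt)}
    {N : ℕ+} (hG : ∀ A, red g N A = 1 → A ∈ G)
    (hN : ∀ p : ℕ, p.Prime → p ≤ 2 * (2 * g).factorial + 1 → p ∣ N)
    (hM : modReduction H (N ^ 2) = modReduction G (N ^ 2))
    (hH : ∀ q : ℕ+, (q : ℕ).Prime → ¬ (q : ℕ) ∣ (N ^ 2 : ℕ+) → modReduction H q = ⊤)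
    (k : ℕ) (hk : 0 < k) :
    ∀ d : ℕ+, (d : ℕ) = k * N ^ 2 → ∀ A ∈ G, ∃ h ∈ H, red g d h = red g d A := by
  induction k using induction_on_primes with
  | zero => exact absurd hk (lt_irrefl 0)
  | one =>
    intro d hd A hA
    obtain rfl : d = N ^ 2 := PNat.eq (by simpa using hd)
    have : red g (N ^ 2) A ∈ modReduction H (N ^ 2) := hM ▸ ⟨A, hA, rfl⟩
    exact this
  | prime_mul p k hp ih =>
    intro n hn A hA
    have hkpos : 0 < k := Nat.pos_of_mul_pos_left hk
    let q : ℕ+ := ⟨p, hp.pos⟩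
    let d : ℕ+ := ⟨k, hkpos⟩ * N ^ 2
    have hd : (d : ℕ) = k * N ^ 2 := rfl
    have hq : (q : ℕ) = p := rfl
    have hnd : (n : ℕ) = d * q := by rw [hn, hd, hq]; ring
    have ihd := ih hkpos d hd
    obtain ⟨h, hh, hhA⟩ := ihd A hA
    have hlarge : ¬ p ∣ N → 2 * (2 * g).factorial + 1 < p := fun h => by
      by_contra h'
      exact h (hN p hp (not_lt.1 h'))
    suffices hB : red g n (A * h⁻¹) ∈ H.map (red g n) by
      obtain ⟨y, hy, hyA⟩ := hB
      exact ⟨y * h, mul_mem hy hh, by rw [map_mul, hyA, ← map_mul, inv_mul_cancel_right]⟩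
    have hB : red g d (A * h⁻¹) = 1 := by rw [map_mul, map_inv, hhA, mul_inv_cancel]
    by_cases hpd : p ∣ d
    -- Here `a = d / p`. The square in `N ^ 2` keeps `a` divisible by `N`, and by `p` too when `p ∣
    -- N`; otherwise `p` is large.
    · obtain ⟨a, hda, hNa, hpa⟩ : ∃ a : ℕ, (d : ℕ) = a * p ∧ (N : ℕ) ∣ a ∧ (5 ≤ p ∨ p ∣ a) := by
        by_cases hpN : p ∣ N
        · obtain ⟨m, hm⟩ := hpN
          refine ⟨k * N * m, ?_, ⟨k * m, by ring⟩, Or.inr ⟨k * m * m, by rw [hm]; ring⟩⟩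
          rw [hd, pow_two]
          nth_rw 2 [hm]
          ring
        · have hpk : p ∣ k := by
            rw [hd] at hpd
            exact (hp.dvd_mul.1 hpd).resolve_right fun h => hpN (hp.dvd_of_dvd_pow h)
          obtain ⟨m, hm⟩ := hpk
          have := hlarge hpN
          have h2 : 2 * g ≤ (2 * g).factorial := Nat.self_le_factorial _
          exact ⟨m * N ^ 2, by rw [hd, hm]; ring, ⟨m * N, by ring⟩, Or.inl (by omega)⟩
      exact red_mem_map_of_prime_dvd hG (q := q) hp hnd hda hNa hpa ihd hB
    · have hpN : ¬ p ∣ (N : ℕ) := fun h => hpd (hd ▸ (h.pow two_ne_zero |>.mul_left _))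
      have hpM : ¬ p ∣ ((N ^ 2 : ℕ+) : ℕ) := by
        rw [PNat.pow_coe]
        exact fun h => hpN (hp.dvd_of_dvd_pow h)
      exact red_mem_map_of_prime_not_dvd hg (q := q) hp hnd hpd (hlarge hpN) (hH q hp hpM) hB

end Sp

theorem proposition2p4 (g : ℕ) (hg : 1 ≤ g) (G : Subgroup (Sp g ProfiniteInt))
    (hG : IsOpen (G : Set (Sp g ProfiniteInt))) :
    ∃ M : ℕ+, ∀ H : Subgroup (Sp g ProfiniteInt),
      IsClosed (H : Set (Sp g ProfiniteInt)) → H ≤ G →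
        (H = G ↔
          modReduction H M = modReduction G M ∧
            ∀ ℓ : ℕ+, Nat.Prime (ℓ : ℕ) → ¬ (ℓ : ℕ) ∣ (M : ℕ) → modReduction H ℓ = ⊤) := by
  obtain ⟨N₀, hN₀⟩ := Sp.exists_forall_red_eq_mem hG (one_mem G)
  set b := 2 * (2 * g).factorial + 1 with hb
  -- The factor `b!` absorbs the primes too small for the argument at a new prime.
  set N : ℕ+ := N₀ * ⟨b.factorial, b.factorial_pos⟩ with hNdef
  have hNcoe : (N : ℕ) = N₀ * b.factorial := rfl
  have hGN : ∀ A, Sp.red g N A = 1 → A ∈ G := fun A hA =>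
    hN₀ A (Sp.red_eq_of_dvd (hNcoe ▸ dvd_mul_right _ _) (by rw [hA, map_one]))
  have hsmall : ∀ p : ℕ, p.Prime → p ≤ b → p ∣ N := fun p hp hpb =>
    hNcoe ▸ (Nat.dvd_factorial hp.pos hpb).mul_left _
  refine ⟨N ^ 2, fun H hclosed hHG => ⟨?_, fun ⟨hM, hH⟩ => le_antisymm hHG fun A hA => ?_⟩⟩
  · rintro rfl
    refine ⟨rfl, fun q hq hqM => Sp.modReduction_eq_top hGN hq fun h => hqM ?_⟩
    rw [PNat.pow_coe]
    exact dvd_pow h two_ne_zero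
  -- Closedness of `H` separates `A` from it by a congruence modulo some `n`, against agreement
  -- modulo `n * N ^ 2`.
  · by_contra hAH
    obtain ⟨n, hn⟩ := Sp.exists_forall_red_eq_mem hclosed.isOpen_compl hAH
    obtain ⟨h, hh, hhA⟩ := Sp.exists_red_eq_of_modReduction_eq hg hGN hsmall hM hH n n.pos
      (n * N ^ 2) (by simp) A hA
    exact hn h (Sp.red_eq_of_dvd (by simp) hhA.symm) hh
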